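/- **Theorem (Lower bound for $(\epsilon,\delta)$-DP).** There is a universal constant $C'>0$ such that the following holds for all $n,m\in\mathbb N$, $\epsilon\in(0,\tfrac12)$, $0\le\delta\le 1$, $p\in[2,\infty)$ and every matrix $A\in\mathbb R^{m\times n}$. Let $\mathcal M$ be a randomized mechanism from $\mathbb R^n$ to $\mathbb R^m$ (for each $x\in\mathbb R^n$, $\mathcal M(x)$ is a random vector in $\mathbb R^m$) that is $(\epsilon,\delta)$-differentially private, i.e. $\Pr[\mathcal M(x)\in S]\le e^{\epsilon}\Pr[\mathcal M(x')\in S]+\delta$ for every measurable $S\subseteq\mathbb R^m$ and all $x,x'\in\mathbb R^n$ with $\|x-x'\|_1\le 1$. Then $$\mathsf{err}_{\ell_p^p}(\mathcal M,A)\;\ge\;\frac{(1-\tilde\delta)\,\gamma_{(p)}(A)}{C'\epsilon},\qquad \tilde\delta=\frac{2e^{2\epsilon}(e^{1/2}-1)}{e^{\epsilon}-1}\,\delta .$$ Here $$\mathsf{err}_{\ell_p^p}(\mathcal M,A)=\sup_{x\in\mathbb R^n}\bigl(\mathbb E\,\|\mathcal M(x)-Ax\|_p^p\bigr)^{1/p}\in[0,\infty],$$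 $$\gamma_{(p)}(A)=\inf\Bigl\{\sqrt{\mathsf{tr}_{p/2}(LL^\top)}\;\|R\|_{1\to2}\;:\;k\in\mathbb N,\ L\in\mathbb R^{m\times k},\ R\in\mathbb R^{k\times n},\ LR=A\Bigr\},$$ where $\mathsf{tr}_{q}(U)=\bigl(\sum_{i}U_{ii}^{q}\bigr)^{1/q}$ and $\|R\|_{1\to 2}=\sup_{\|x\|_1\le 1}\|Rx\|_2$. -/

import Mathlib

open MeasureTheory
open scoped ENNReal Matrix

noncomputable section

namespace LinearQueryDP

/-- A randomized algorithm `ℝⁿ → ℝᵐ`, given by its output distributions: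
`M x` is the law of the random output on the dataset `x`. -/
abbrev Mechanism (n m : ℕ) : Type :=
  (Fin n → ℝ) → ProbabilityMeasure (Fin m → ℝ)

/-- Two datasets are neighboring if `‖x - x'‖₁ ≤ 1`. -/
def Neighboring {n : ℕ} (x x' : Fin n → ℝ) : Prop :=
  ‖WithLp.toLp 1 (x - x')‖ ≤ 1

/-- `(ε, δ)`-differential privacy:
`Pr[M(x) ∈ S] ≤ e^ε Pr[M(x') ∈ S] + δ` for all neighboring `x, x'` and all measurable `S`. -/
def IsDP {n m : ℕ} (M : Mechanism n m) (ε δ : ℝ) : Prop :=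
  ∀ x x' : Fin n → ℝ, Neighboring x x' → ∀ S : Set (Fin m → ℝ), MeasurableSet S →
    (M x : Measure (Fin m → ℝ)) S ≤
      ENNReal.ofReal (Real.exp ε) * (M x' : Measure (Fin m → ℝ)) S + ENNReal.ofReal δ

/-- The worst-case error `sup_x (𝔼 ‖M(x) - A x‖_p^p)^(1/p)`, as an element of `[0, ∞]`. -/
def err {n m : ℕ} (p : ℝ) (M : Mechanism n m) (A : Matrix (Fin m) (Fin n) ℝ) : ℝ≥0∞ :=
  ⨆ x : Fin n → ℝ,
    (∫⁻ y, ENNReal.ofReal (‖WithLp.toLp (ENNReal.ofReal p) (y - A *ᵥ x)‖ ^ p)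
      ∂(M x : Measure (Fin m → ℝ))) ^ (1 / p)

/-- The `p`-trace `(∑ i, U_ii ^ p) ^ (1 / p)` for finite `p`. -/
def pTrace {d : ℕ} (p : ℝ) (U : Matrix (Fin d) (Fin d) ℝ) : ℝ :=
  (∑ i, U i i ^ p) ^ (1 / p)

/-- The operator norm `‖R‖_{1 → 2}` from `ℓ₁` to `ℓ₂`. -/
def norm1to2 {k n : ℕ} (R : Matrix (Fin k) (Fin n) ℝ) : ℝ :=
  sSup {r : ℝ | ∃ x : Fin n → ℝ, ‖WithLp.toLp 1 x‖ ≤ 1 ∧ r = ‖WithLp.toLp 2 (R *ᵥ x)‖}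

/-- The generalized factorization norm `γ_(p)(A)`: the infimum of
`√(tr_{p/2}(L Lᵀ)) ‖R‖_{1 → 2}` over all factorizations `L R = A` with any inner dimension. -/
def gammaNorm {m n : ℕ} (p : ℝ) (A : Matrix (Fin m) (Fin n) ℝ) : ℝ :=
  sInf {r : ℝ | ∃ (k : ℕ) (L : Matrix (Fin m) (Fin k) ℝ) (R : Matrix (Fin k) (Fin n) ℝ),
    L * R = A ∧ r = √(pTrace (p / 2) (L * Lᵀ)) * norm1to2 R}

/-- `δ̃ = 2 e^{2ε} (e^{1/2} - 1) δ / (e^ε - 1)`. -/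
def deltaTilde (ε δ : ℝ) : ℝ :=
  2 * Real.exp (2 * ε) * (Real.exp (1 / 2) - 1) / (Real.exp ε - 1) * δ

end LinearQueryDP

end

noncomputable section

namespace LinearQueryDP

/-! Run `M` on a uniformly random vertex of the cube {0, k}ⁿ with k ≈ 1/(2ε), and let z be its
error. Flipping coordinate j moves the true answer by k|θ·a_j| in direction θ (a_j is the j-th
column of `A`), while group privacy over k steps keeps the two output laws comparable. So |θ·z| ≥
k|θ·a_j|/2 with probability of constant order, and Markov gives (θ·a_j)² ≤ K² E(θ·z)² with K =
16ε/(1 - δ̃) (`IsDP.sq_le_integral_cubeNoise`). The uniform law is invariant under every flip, so a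
single z serves all columns.

The second moment matrix U of z therefore dominates every a_j. Writing U = LLᵀ gives `A` = LR with
the columns of R of norm at most K (`gammaNorm_le_of_posSemidef`). Jensen, using p ≥ 2, bounds
√tr_{p/2}(U) by the ℓ_p error of z (`gammaNorm_le_of_noise`), an average over vertices and hence at
most the supremum `err`. -/

/-! ### Factorizations from dominating quadratic forms. -/

/-- The column space of a square matrix contains every vector that is controlled by its
quadratic form. -/
theorem exists_mulVec_eq_of_sq_le {m : ℕ} {U : Matrix (Fin m) (Fin m) ℝ}
    {a : Fin m → ℝ} {K : ℝ} (h : ∀ θ : Fin m → ℝ, (θ ⬝ᵥ a) ^ 2 ≤ K * (θ ⬝ᵥ U *ᵥ θ)) :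
    ∃ θ, U *ᵥ θ = a := by
  by_contra hne
  have hmem : a ∉ LinearMap.range U.mulVecLin := by
    rintro ⟨θ, hθ⟩
    exact hne ⟨θ, by simpa using hθ⟩
  -- Duality: some φ kills the range of `U` but not `a`; the hypothesis at θ = φ forces φ·a = 0.
  obtain ⟨f, hfa, hf⟩ := Submodule.exists_le_ker_of_notMem hmem
  obtain ⟨φ, rfl⟩ := (dotProductEquiv ℝ (Fin m)).surjective f
  have hker : ∀ θ : Fin m → ℝ, φ ⬝ᵥ U *ᵥ θ = 0 := fun θ => by
    have := hf ⟨θ, rfl⟩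
    simpa using this
  have h1 := h φ
  rw [hker φ, mul_zero] at h1
  exact hfa (by simpa using pow_eq_zero_iff two_ne_zero |>.1 (le_antisymm h1 (sq_nonneg _)))

/-- Rx combines the columns with coefficients of total absolute value at most 1. -/
theorem norm1to2_le {k n : ℕ} {R : Matrix (Fin k) (Fin n) ℝ} {K : ℝ} (hK : 0 ≤ K)
    (h : ∀ j, ‖WithLp.toLp 2 (fun i => R i j)‖ ≤ K) : norm1to2 R ≤ K := by
  refine Real.sSup_le ?_ hK
  rintro r ⟨x, hx, rfl⟩
  have h1 : WithLp.toLp 2 (R *ᵥ x) = ∑ j, x j • WithLp.toLp 2 (fun i => R i j) := by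
    ext i
    simp [Matrix.mulVec, dotProduct, mul_comm]
  have h2 : ‖WithLp.toLp 1 x‖ = ∑ j, |x j| := by
    rw [PiLp.norm_eq_sum (by simp)]
    simp
  calc ‖WithLp.toLp 2 (R *ᵥ x)‖ ≤ ∑ j, ‖x j • WithLp.toLp 2 (fun i => R i j)‖ := by
        rw [h1]; exact norm_sum_le _ _
    _ ≤ ∑ j, |x j| * K := by
        refine Finset.sum_le_sum fun j _ => ?_
        rw [norm_smul, Real.norm_eq_abs]
        exact mul_le_mul_of_nonneg_left (h j) (abs_nonneg _)
    _ ≤ K := by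
        rw [← Finset.sum_mul, ← h2]
        exact mul_le_of_le_one_left hK hx

theorem norm1to2_nonneg {k n : ℕ} (R : Matrix (Fin k) (Fin n) ℝ) : 0 ≤ norm1to2 R := by
  refine Real.sSup_nonneg ?_
  rintro r ⟨x, -, rfl⟩
  exact norm_nonneg _

theorem gammaNorm_nonneg {m n : ℕ} (p : ℝ) (A : Matrix (Fin m) (Fin n) ℝ) :
    0 ≤ gammaNorm p A := by
  refine Real.sInf_nonneg ?_
  rintro r ⟨k, L, R, -, rfl⟩
  exact mul_nonneg (Real.sqrt_nonneg _) (norm1to2_nonneg R)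

theorem gammaNorm_le_of_factorization {m n k : ℕ} (p : ℝ) {A : Matrix (Fin m) (Fin n) ℝ}
    {L : Matrix (Fin m) (Fin k) ℝ} {R : Matrix (Fin k) (Fin n) ℝ} (h : L * R = A) :
    gammaNorm p A ≤ √(pTrace (p / 2) (L * Lᵀ)) * norm1to2 R := by
  refine csInf_le ⟨0, ?_⟩ ⟨k, L, R, h, rfl⟩
  rintro r ⟨k, L, R, -, rfl⟩
  exact mul_nonneg (Real.sqrt_nonneg _) (norm1to2_nonneg R)

open scoped MatrixOrder Matrix.Norms.L2Operator in
/-- A positive semidefinite matrix whose quadratic form dominates all columns of `A`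
yields a factorization of `A`. -/
theorem gammaNorm_le_of_posSemidef {m n : ℕ} (p : ℝ) {A : Matrix (Fin m) (Fin n) ℝ}
    {U : Matrix (Fin m) (Fin m) ℝ} (hU : U.PosSemidef) {K : ℝ} (hK : 0 ≤ K)
    (h : ∀ (θ : Fin m → ℝ) (j : Fin n), (θ ⬝ᵥ A.col j) ^ 2 ≤ K ^ 2 * (θ ⬝ᵥ U *ᵥ θ)) :
    gammaNorm p A ≤ √(pTrace (p / 2) U) * K := by
  choose Θ hΘ using fun j => exists_mulVec_eq_of_sq_le (fun θ => h θ j)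
  obtain ⟨L, hL⟩ : ∃ L : Matrix (Fin m) (Fin m) ℝ, U = L * Lᵀ := by
    obtain ⟨B, hB⟩ := CStarAlgebra.nonneg_iff_eq_star_mul_self.1 hU.nonneg
    exact ⟨Bᵀ, by simpa [Matrix.star_eq_conjTranspose] using hB⟩
  -- With UΘ_j = a_j, this choice gives LR = LLᵀΘ = UΘ = A.
  set R : Matrix (Fin m) (Fin n) ℝ := Lᵀ * (Matrix.of fun i j => Θ j i) with hR
  have hcol : ∀ j, (fun i => R i j) = Lᵀ *ᵥ Θ j := fun j => by
    ext i
    simp [hR, Matrix.mul_apply, Matrix.mulVec, dotProduct]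
  have hLR : L * R = A := by
    rw [hR, ← Matrix.mul_assoc, ← hL]
    ext i j
    have := congrFun (hΘ j) i
    simpa [Matrix.mul_apply, Matrix.mulVec, dotProduct] using this
  have hRK : norm1to2 R ≤ K := by
    refine norm1to2_le hK fun j => ?_
    have h1 : ‖WithLp.toLp 2 (fun i => R i j)‖ ^ 2 = Θ j ⬝ᵥ A.col j := by
      rw [hcol, EuclideanSpace.norm_sq_eq, ← hΘ j, hL, ← Matrix.mulVec_mulVec,
        Matrix.dotProduct_mulVec, ← Matrix.mulVec_transpose]
      simp [dotProduct, sq]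
    -- At θ = Θ_j the domination reads r⁴ ≤ K²r², where r is the norm of the j-th column of `R`.
    have h2 := h (Θ j) j
    rw [hΘ j, ← h1] at h2
    set r := ‖WithLp.toLp 2 (fun i => R i j)‖ with hr
    have hr0 : 0 ≤ r := norm_nonneg _
    by_contra! hlt
    have h3 : K ^ 2 < r ^ 2 := by gcongr
    have h4 : 0 < r ^ 2 := (sq_nonneg K).trans_lt h3
    nlinarith
  calc gammaNorm p A ≤ √(pTrace (p / 2) (L * Lᵀ)) * norm1to2 R :=
        gammaNorm_le_of_factorization p hLR
    _ ≤ √(pTrace (p / 2) U) * K := by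
        rw [← hL]
        exact mul_le_mul_of_nonneg_left hRK (Real.sqrt_nonneg _)

/-! ### Second moments of a noise distribution. -/

/-- The matrix of second moments of `μ`. -/
def secondMoment {m : ℕ} (μ : Measure (Fin m → ℝ)) : Matrix (Fin m) (Fin m) ℝ :=
  Matrix.of fun i j => ∫ z, z i * z j ∂μ

theorem dotProduct_secondMoment_mulVec {m : ℕ} {μ : Measure (Fin m → ℝ)}
    (h : ∀ i, MemLp (fun z => z i) 2 μ) (θ : Fin m → ℝ) :
    θ ⬝ᵥ secondMoment μ *ᵥ θ = ∫ z, (θ ⬝ᵥ z) ^ 2 ∂μ := by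
  have hint : ∀ i j, Integrable (fun z => z i * z j) μ := fun i j => (h i).integrable_mul (h j)
  have hexp : ∀ z : Fin m → ℝ, (θ ⬝ᵥ z) ^ 2 = ∑ i, ∑ j, θ i * θ j * (z i * z j) := fun z => by
    rw [sq, dotProduct, Finset.sum_mul_sum]
    exact Finset.sum_congr rfl fun i _ => Finset.sum_congr rfl fun j _ => by ring
  simp_rw [hexp]
  rw [integral_finsetSum _ fun i _ => integrable_finsetSum _ fun j _ => (hint i j).const_mul _]
  refine Finset.sum_congr rfl fun i _ => ?_
  rw [integral_finsetSum _ fun j _ => (hint i j).const_mul _]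
  simp_rw [integral_const_mul]
  rw [Matrix.mulVec, dotProduct, Finset.mul_sum]
  exact Finset.sum_congr rfl fun j _ => by simp [secondMoment]; ring

theorem posSemidef_secondMoment {m : ℕ} {μ : Measure (Fin m → ℝ)}
    (h : ∀ i, MemLp (fun z => z i) 2 μ) : (secondMoment μ).PosSemidef := by
  refine Matrix.PosSemidef.of_dotProduct_mulVec_nonneg ?_ fun θ => ?_
  · ext i j
    simp [secondMoment, mul_comm]
  · rw [star_trivial, dotProduct_secondMoment_mulVec h]
    exact integral_nonneg fun z => sq_nonneg _

/-- Jensen's inequality for the diagonal of the second moment matrix. -/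
theorem secondMoment_diag_rpow_le {m : ℕ} {μ : Measure (Fin m → ℝ)} [IsProbabilityMeasure μ]
    {p : ℝ} (hp : 2 ≤ p) (h : ∀ i, MemLp (fun z => z i) 2 μ)
    (hint : ∀ i, Integrable (fun z => |z i| ^ p) μ) (i : Fin m) :
    secondMoment μ i i ^ (p / 2) ≤ ∫ z, |z i| ^ p ∂μ := by
  have hpow : ∀ x : ℝ, (x * x) ^ (p / 2) = |x| ^ p := fun x => by
    rw [← abs_mul_abs_self, ← sq, ← Real.rpow_natCast, ← Real.rpow_mul (abs_nonneg _)]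
    congr 1
    push_cast
    ring
  have := (convexOn_rpow (show 1 ≤ p / 2 by linarith)).map_integral_le (μ := μ)
    (f := fun z : Fin m → ℝ => z i * z i)
    (continuousOn_id.rpow_const fun _ _ => Or.inr (by linarith)) isClosed_Ici
    (Filter.Eventually.of_forall fun z => Set.mem_Ici.2 (mul_self_nonneg _)) ((h i).integrable_mul (h i))
    (by simpa only [Function.comp_def, hpow] using hint i)
  simpa only [hpow, secondMoment, Matrix.of_apply] using this

theorem memLp_two_of_integrable_rpow {m : ℕ} {μ : Measure (Fin m → ℝ)} [IsProbabilityMeasure μ]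
    {p : ℝ} (hp : 2 ≤ p) {i : Fin m} (hint : Integrable (fun z => |z i| ^ p) μ) :
    MemLp (fun z => z i) 2 μ := by
  have hp0 : 0 < p := by linarith
  have : MemLp (fun z : Fin m → ℝ => z i) (ENNReal.ofReal p) μ := by
    rw [← integrable_norm_rpow_iff (measurable_pi_apply i).aestronglyMeasurable
      (by simpa using hp0) (by simp)]
    simpa [ENNReal.toReal_ofReal hp0.le] using hint
  refine this.mono_exponent ?_
  rw [← ENNReal.ofReal_ofNat]
  exact ENNReal.ofReal_le_ofReal hp

/-- `γ_(p)(A)` is at most `K` times the `ℓ_p` error of a noise distribution whose second moments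
dominate the columns of `A`. -/
theorem gammaNorm_le_of_noise {m n : ℕ} {p : ℝ} (hp : 2 ≤ p) {A : Matrix (Fin m) (Fin n) ℝ}
    {μ : Measure (Fin m → ℝ)} [IsProbabilityMeasure μ]
    (hint : ∀ i, Integrable (fun z => |z i| ^ p) μ) {K : ℝ} (hK : 0 ≤ K)
    (hA : ∀ (θ : Fin m → ℝ) (j : Fin n),
      (θ ⬝ᵥ A.col j) ^ 2 ≤ K ^ 2 * ∫ z, (θ ⬝ᵥ z) ^ 2 ∂μ) :
    gammaNorm p A ≤ (∑ i, ∫ z, |z i| ^ p ∂μ) ^ (1 / p) * K := by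
  have hL := fun i => memLp_two_of_integrable_rpow hp (hint i)
  have hdiag : ∀ i, 0 ≤ secondMoment μ i i := fun i => integral_nonneg fun z => mul_self_nonneg _
  refine (gammaNorm_le_of_posSemidef p (posSemidef_secondMoment hL) hK fun θ j => ?_).trans ?_
  · rw [dotProduct_secondMoment_mulVec hL]
    exact hA θ j
  · gcongr
    rw [Real.sqrt_eq_rpow, pTrace, ← Real.rpow_mul
      (Finset.sum_nonneg fun i _ => Real.rpow_nonneg (hdiag i) _)]
    rw [show 1 / (p / 2) * (1 / 2) = 1 / p by field_simp]
    gcongr with i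
    · exact Finset.sum_nonneg fun i _ => Real.rpow_nonneg (hdiag i) _
    · exact secondMoment_diag_rpow_le hp hL hint i

/-! ### Group privacy and the two-point lower bound. -/

theorem IsDP.real_le {n m : ℕ} {M : Mechanism n m} {ε δ : ℝ} (hδ : 0 ≤ δ) (hM : IsDP M ε δ)
    {x x' : Fin n → ℝ} (h : Neighboring x x') {S : Set (Fin m → ℝ)} (hS : MeasurableSet S) :
    (M x : Measure (Fin m → ℝ)).real S ≤
      Real.exp ε * (M x' : Measure (Fin m → ℝ)).real S + δ := by
  have h1 := hM x x' h S hS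
  rw [← ofReal_measureReal, ← ofReal_measureReal, ← ENNReal.ofReal_mul (Real.exp_pos _).le,
    ← ENNReal.ofReal_add (by positivity) hδ, ENNReal.ofReal_le_ofReal_iff (by positivity)] at h1
  exact h1

/-- Group privacy along `k` steps in direction `d`. -/
theorem IsDP.group {n m : ℕ} {M : Mechanism n m} {ε δ : ℝ} (hε : 0 < ε) (hδ : 0 ≤ δ)
    (hM : IsDP M ε δ) {d : Fin n → ℝ} (hd : ‖WithLp.toLp 1 d‖ ≤ 1) {S : Set (Fin m → ℝ)}
    (hS : MeasurableSet S) (k : ℕ) (x : Fin n → ℝ) :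
    (M x : Measure (Fin m → ℝ)).real S ≤
      Real.exp (k * ε) * (M (x + (k : ℝ) • d) : Measure (Fin m → ℝ)).real S +
        δ * ((Real.exp (k * ε) - 1) / (Real.exp ε - 1)) := by
  have he : 0 < Real.exp ε - 1 := by
    have := Real.add_one_lt_exp hε.ne'
    linarith
  induction k generalizing x with
  | zero => simp
  | succ k ih =>
    have hn : Neighboring x (x + d) := by
      have : WithLp.toLp 1 (x - (x + d)) = -WithLp.toLp 1 d := by
        rw [← WithLp.toLp_neg]; congr 1; abel
      rw [Neighboring, this, norm_neg]
      exact hd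
    have h1 := hM.real_le hδ hn hS
    have h2 := ih (x + d)
    have hx : x + d + (k : ℝ) • d = x + ((k + 1 : ℕ) : ℝ) • d := by
      push_cast
      module
    rw [hx] at h2
    have hexp : Real.exp ((k + 1 : ℕ) * ε) = Real.exp ε * Real.exp (k * ε) := by
      rw [← Real.exp_add]; congr 1; push_cast; ring
    rw [hexp]
    refine h1.trans ?_
    have h3 := mul_le_mul_of_nonneg_left h2 (Real.exp_pos ε).le
    -- The quotient is the geometric sum 1 + e^ε + … + e^{kε}, which obeys g_{k+1} = e^ε g_k + 1.
    have h4 : δ * ((Real.exp ε * Real.exp (k * ε) - 1) / (Real.exp ε - 1)) =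
        Real.exp ε * (δ * ((Real.exp (k * ε) - 1) / (Real.exp ε - 1))) + δ := by
      field_simp
      ring
    rw [h4]
    linarith

/-- On two datasets at distance `k`, a private mechanism must err by half the distance
between the true answers with constant total probability. -/
theorem IsDP.pair_lower_bound {n m : ℕ} {M : Mechanism n m} {ε δ : ℝ} (hε : 0 < ε) (hδ : 0 ≤ δ)
    (hM : IsDP M ε δ) {d : Fin n → ℝ} (hd : ‖WithLp.toLp 1 d‖ ≤ 1) {k : ℕ} (hk : k * ε ≤ 1 / 2)
    (A : Matrix (Fin m) (Fin n) ℝ) (θ : Fin m → ℝ) (x x' : Fin n → ℝ)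
    (hx' : x' = x + (k : ℝ) • d) {t : ℝ} (ht : 2 * t ≤ k * |θ ⬝ᵥ A *ᵥ d|) :
    1 - δ * ((Real.exp (1 / 2) - 1) / (Real.exp ε - 1)) ≤
      2 * ((M x : Measure (Fin m → ℝ)).real {y | t ≤ |θ ⬝ᵥ (y - A *ᵥ x)|} +
        (M x' : Measure (Fin m → ℝ)).real {y | t ≤ |θ ⬝ᵥ (y - A *ᵥ x')|}) := by
  have he : 0 < Real.exp ε - 1 := by
    have := Real.add_one_lt_exp hε.ne'
    linarith
  have hmeas : ∀ u, MeasurableSet {y | t ≤ |θ ⬝ᵥ (y - A *ᵥ u)|} := fun u =>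
    measurableSet_le measurable_const (by unfold dotProduct; fun_prop)
  have hg := hM.group hε hδ hd (hmeas x).compl k x
  rw [← hx', probReal_compl_eq_one_sub (hmeas x)] at hg
  -- The true answers differ by at least 2t along θ, so an output within t of one is at least t from
  -- the other.
  have hsub : (M x' : Measure (Fin m → ℝ)).real {y | t ≤ |θ ⬝ᵥ (y - A *ᵥ x)|}ᶜ ≤
      (M x' : Measure (Fin m → ℝ)).real {y | t ≤ |θ ⬝ᵥ (y - A *ᵥ x')|} := by
    refine measureReal_mono fun y hy => ?_
    simp only [Set.mem_compl_iff, Set.mem_ofPred_eq, not_le] at hy ⊢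
    have h1 : θ ⬝ᵥ (y - A *ᵥ x') = θ ⬝ᵥ (y - A *ᵥ x) - k * (θ ⬝ᵥ A *ᵥ d) := by
      rw [hx', Matrix.mulVec_add, Matrix.mulVec_smul, ← sub_sub, dotProduct_sub,
        dotProduct_smul, smul_eq_mul]
    have h2 := abs_sub_abs_le_abs_sub ((k : ℝ) * (θ ⬝ᵥ A *ᵥ d)) (θ ⬝ᵥ (y - A *ᵥ x))
    rw [abs_sub_comm, ← h1, abs_mul, Nat.abs_cast] at h2
    linarith
  have hexp : Real.exp (k * ε) ≤ Real.exp (1 / 2) := Real.exp_le_exp.2 hk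
  have hexp2 : Real.exp (1 / 2) ≤ 2 := by
    have h1 := Real.exp_one_lt_d9
    have h2 : Real.exp (1 / 2) * Real.exp (1 / 2) = Real.exp 1 := by
      rw [← Real.exp_add]; norm_num
    nlinarith [Real.exp_pos (1 / 2)]
  have h3 : δ * ((Real.exp (k * ε) - 1) / (Real.exp ε - 1)) ≤
      δ * ((Real.exp (1 / 2) - 1) / (Real.exp ε - 1)) := by gcongr
  have h4 := mul_le_mul (hexp.trans hexp2) hsub measureReal_nonneg (by norm_num)
  have h5 : 0 ≤ (M x : Measure (Fin m → ℝ)).real {y | t ≤ |θ ⬝ᵥ (y - A *ᵥ x)|} :=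
    measureReal_nonneg
  linarith

/-! ### Uniform mixtures. -/

/-- The uniform mixture of a finite family of measures. -/
def uniformMixture {ι Ω : Type*} [Fintype ι] [MeasurableSpace Ω] (μ : ι → Measure Ω) :
    Measure Ω :=
  (Fintype.card ι : ℝ≥0∞)⁻¹ • ∑ i, μ i

instance {ι Ω : Type*} [Fintype ι] [Nonempty ι] [MeasurableSpace Ω] (μ : ι → Measure Ω)
    [∀ i, IsProbabilityMeasure (μ i)] : IsProbabilityMeasure (uniformMixture μ) := by
  refine ⟨?_⟩
  simp [uniformMixture, ENNReal.inv_mul_cancel]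

theorem uniformMixture_real {ι Ω : Type*} [Fintype ι] [MeasurableSpace Ω] (μ : ι → Measure Ω)
    [∀ i, IsProbabilityMeasure (μ i)] (S : Set Ω) :
    (uniformMixture μ).real S = (Fintype.card ι : ℝ)⁻¹ * ∑ i, (μ i).real S := by
  simp [uniformMixture, measureReal_def, ENNReal.toReal_sum]

theorem lintegral_uniformMixture_le {ι Ω : Type*} [Fintype ι] [Nonempty ι] [MeasurableSpace Ω]
    {μ : ι → Measure Ω} {f : Ω → ℝ≥0∞} {c : ℝ≥0∞} (h : ∀ i, ∫⁻ z, f z ∂μ i ≤ c) :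
    ∫⁻ z, f z ∂uniformMixture μ ≤ c := by
  rw [uniformMixture, lintegral_smul_measure, lintegral_finsetSum_measure]
  calc (Fintype.card ι : ℝ≥0∞)⁻¹ • ∑ i, ∫⁻ z, f z ∂μ i
      ≤ (Fintype.card ι : ℝ≥0∞)⁻¹ • ∑ _i : ι, c := by
        gcongr with i
        exact h i
    _ = c := by
        rw [Finset.sum_const, Finset.card_univ, nsmul_eq_mul, smul_eq_mul, ← mul_assoc,
          ENNReal.inv_mul_cancel (by simp) (by simp), one_mul]

/-- Lower bounds on pairs matched by a permutation pass to the mixture. -/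
theorem le_uniformMixture_real {ι Ω : Type*} [Fintype ι] [Nonempty ι] [MeasurableSpace Ω]
    {μ : ι → Measure Ω} [∀ i, IsProbabilityMeasure (μ i)] {S : Set Ω} (σ : Equiv.Perm ι) {c : ℝ}
    (h : ∀ i, c ≤ (μ i).real S + (μ (σ i)).real S) :
    c ≤ 2 * (uniformMixture μ).real S := by
  rw [uniformMixture_real]
  have h1 : ∑ _i : ι, c ≤ ∑ i, ((μ i).real S + (μ (σ i)).real S) :=
    Finset.sum_le_sum fun i _ => h i
  rw [Finset.sum_add_distrib, Equiv.sum_comp σ fun i => (μ i).real S, Finset.sum_const,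
    Finset.card_univ, nsmul_eq_mul] at h1
  have hc : (0 : ℝ) < Fintype.card ι := by exact_mod_cast Fintype.card_pos
  rw [← mul_assoc, mul_comm 2, mul_assoc, ← div_eq_inv_mul, le_div_iff₀ hc]
  linarith

/-! ### Noise on the random cube vertex. -/

/-- A vertex of the cube `{0, k}ⁿ`. -/
def cubeVertex {n : ℕ} (k : ℕ) (v : Fin n → Bool) : Fin n → ℝ :=
  fun i => if v i then (k : ℝ) else 0

/-- The error of `M` on a uniformly random vertex of the cube `{0, k}ⁿ`. -/
def cubeNoise {n m : ℕ} (M : Mechanism n m) (A : Matrix (Fin m) (Fin n) ℝ) (k : ℕ) :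
    Measure (Fin m → ℝ) :=
  uniformMixture fun v : Fin n → Bool =>
    (M (cubeVertex k v) : Measure (Fin m → ℝ)).map (fun y => y - A *ᵥ cubeVertex k v)

instance {n m : ℕ} (M : Mechanism n m) (A : Matrix (Fin m) (Fin n) ℝ) (k : ℕ)
    (v : Fin n → Bool) : IsProbabilityMeasure
      ((M (cubeVertex k v) : Measure (Fin m → ℝ)).map (fun y => y - A *ᵥ cubeVertex k v)) :=
  Measure.isProbabilityMeasure_map (by fun_prop)

instance {n m : ℕ} (M : Mechanism n m) (A : Matrix (Fin m) (Fin n) ℝ) (k : ℕ) :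
    IsProbabilityMeasure (cubeNoise M A k) := by
  unfold cubeNoise
  infer_instance

/-- The permutation of the cube flipping the coordinate `j`. -/
def cubeFlip {n : ℕ} (j : Fin n) : Equiv.Perm (Fin n → Bool) :=
  Function.Involutive.toPerm (fun v => Function.update v j (!v j)) fun v => by simp

/-- A flip is k steps along a signed unit vector, the form needed for group privacy. -/
theorem exists_cubeVertex_cubeFlip {n : ℕ} (k : ℕ) (v : Fin n → Bool) (j : Fin n) :
    ∃ s : ℝ, |s| = 1 ∧
      cubeVertex k (cubeFlip j v) = cubeVertex k v + (k : ℝ) • s • Pi.single j 1 := by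
  have hflip : cubeFlip j v = Function.update v j (!v j) := rfl
  refine ⟨if v j then -1 else 1, by split_ifs <;> simp, ?_⟩
  ext i
  rcases eq_or_ne i j with rfl | hij
  · cases h : v i <;> simp [cubeVertex, hflip, h]
  · cases v j <;> simp [cubeVertex, hflip, hij]

/-- The two-point bound holds on each pair matched by the flip of j. The factor 4 is 2 from that
bound (e^{1/2} ≤ 2) times 2 from averaging over pairs. -/
theorem IsDP.cubeNoise_tail {n m : ℕ} {M : Mechanism n m} {ε δ : ℝ} (hε : 0 < ε) (hδ : 0 ≤ δ)
    (hM : IsDP M ε δ) {k : ℕ} (hk : k * ε ≤ 1 / 2)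
    (A : Matrix (Fin m) (Fin n) ℝ) (θ : Fin m → ℝ) (j : Fin n) :
    1 - δ * ((Real.exp (1 / 2) - 1) / (Real.exp ε - 1)) ≤
      4 * (cubeNoise M A k).real {z | k * |θ ⬝ᵥ A.col j| / 2 ≤ |θ ⬝ᵥ z|} := by
  set t := k * |θ ⬝ᵥ A.col j| / 2 with ht
  have hmeas : MeasurableSet {z : Fin m → ℝ | t ≤ |θ ⬝ᵥ z|} :=
    measurableSet_le measurable_const (by unfold dotProduct; fun_prop)
  have key := le_uniformMixture_real (S := {z : Fin m → ℝ | t ≤ |θ ⬝ᵥ z|})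
    (μ := fun v : Fin n → Bool =>
      (M (cubeVertex k v) : Measure (Fin m → ℝ)).map (fun y => y - A *ᵥ cubeVertex k v))
    (cubeFlip j) (c := (1 - δ * ((Real.exp (1 / 2) - 1) / (Real.exp ε - 1))) / 2) fun v => by
      rw [map_measureReal_apply (by fun_prop) hmeas, map_measureReal_apply (by fun_prop) hmeas]
      obtain ⟨s, hs, hflip⟩ := exists_cubeVertex_cubeFlip k v j
      have hd : ‖WithLp.toLp 1 (s • Pi.single j (1 : ℝ))‖ ≤ 1 := by
        rw [WithLp.toLp_smul, norm_smul, Real.norm_eq_abs, hs, one_mul]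
        exact (PiLp.norm_single 1 (fun _ => ℝ) j 1).trans_le (by simp)
      have h := hM.pair_lower_bound hε hδ hd hk A θ _ _ hflip (t := t) (by
        rw [Matrix.mulVec_smul, Matrix.mulVec_single_one, dotProduct_smul, smul_eq_mul, abs_mul,
          hs, one_mul, ht]
        linarith)
      simp only [Set.preimage_ofPred_eq]
      linarith
  have : uniformMixture (fun v : Fin n → Bool =>
      (M (cubeVertex k v) : Measure (Fin m → ℝ)).map (fun y => y - A *ᵥ cubeVertex k v)) =
      cubeNoise M A k := rfl
  rw [this] at key
  linarith

theorem lintegral_cubeNoise_le {n m : ℕ} {p : ℝ} (hp : 0 < p) (M : Mechanism n m)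
    (A : Matrix (Fin m) (Fin n) ℝ) (k : ℕ) :
    ∫⁻ z, ENNReal.ofReal (‖WithLp.toLp (ENNReal.ofReal p) z‖ ^ p) ∂cubeNoise M A k ≤
      err p M A ^ p := by
  refine lintegral_uniformMixture_le fun v => ?_
  have hmeas : Measurable fun z : Fin m → ℝ =>
      ENNReal.ofReal (‖WithLp.toLp (ENNReal.ofReal p) z‖ ^ p) := by
    have hp' : 0 < (ENNReal.ofReal p).toReal := by rwa [ENNReal.toReal_ofReal hp.le]
    simp only [PiLp.norm_eq_sum hp']
    fun_prop
  rw [lintegral_map hmeas (by fun_prop), ← ENNReal.rpow_inv_le_iff hp, ← one_div]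
  exact le_iSup (fun x : Fin n → ℝ =>
    (∫⁻ y, ENNReal.ofReal (‖WithLp.toLp (ENNReal.ofReal p) (y - A *ᵥ x)‖ ^ p)
      ∂(M x : Measure (Fin m → ℝ))) ^ (1 / p)) (cubeVertex k v)

theorem norm_toLp_rpow {m : ℕ} {p : ℝ} (hp : 0 < p) (z : Fin m → ℝ) :
    ‖WithLp.toLp (ENNReal.ofReal p) z‖ ^ p = ∑ i, |z i| ^ p := by
  have hp' : (ENNReal.ofReal p).toReal = p := ENNReal.toReal_ofReal hp.le
  rw [PiLp.norm_eq_sum (hp'.symm ▸ hp), hp', ← Real.rpow_mul (by positivity), one_div,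
    inv_mul_cancel₀ hp.ne', Real.rpow_one]
  simp

theorem integrable_cubeNoise {n m : ℕ} {p : ℝ} (hp : 0 < p) {M : Mechanism n m}
    {A : Matrix (Fin m) (Fin n) ℝ} (k : ℕ) (h : err p M A ≠ ∞) (i : Fin m) :
    Integrable (fun z => |z i| ^ p) (cubeNoise M A k) := by
  refine ⟨Measurable.aestronglyMeasurable (by fun_prop), ?_⟩
  rw [hasFiniteIntegral_iff_ofReal (Filter.Eventually.of_forall fun z => by positivity)]
  refine lt_of_le_of_lt ?_ (lt_of_le_of_lt (lintegral_cubeNoise_le hp M A k)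
    (ENNReal.rpow_lt_top_of_nonneg hp.le h))
  refine lintegral_mono fun z => ENNReal.ofReal_le_ofReal ?_
  rw [norm_toLp_rpow hp]
  exact Finset.single_le_sum (f := fun i => |z i| ^ p) (fun i _ => by positivity)
    (Finset.mem_univ i)

theorem sum_integral_cubeNoise_rpow_le {n m : ℕ} {p : ℝ} (hp : 0 < p) {M : Mechanism n m}
    {A : Matrix (Fin m) (Fin n) ℝ} (k : ℕ) (h : err p M A ≠ ∞) :
    (∑ i, ∫ z, |z i| ^ p ∂cubeNoise M A k) ^ (1 / p) ≤ (err p M A).toReal := by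
  have h1 := lintegral_cubeNoise_le hp M A k
  simp_rw [norm_toLp_rpow hp] at h1
  rw [← ofReal_integral_eq_lintegral_ofReal
      (integrable_finsetSum _ fun i _ => integrable_cubeNoise hp k h i)
      (Filter.Eventually.of_forall fun z => by positivity),
    integral_finsetSum _ fun i _ => integrable_cubeNoise hp k h i] at h1
  have h2 := ENNReal.toReal_mono (ENNReal.rpow_lt_top_of_nonneg hp.le h).ne h1
  have h3 : 0 ≤ ∑ i, ∫ z, |z i| ^ p ∂cubeNoise M A k :=
    Finset.sum_nonneg fun i _ => integral_nonneg fun z => by positivity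
  rw [ENNReal.toReal_ofReal h3, ← ENNReal.toReal_rpow] at h2
  rwa [one_div, Real.rpow_inv_le_iff_of_pos h3 ENNReal.toReal_nonneg hp]

/-- The noise has variance at least of order `1 / ε²` along every column of `A`. -/
theorem IsDP.sq_le_integral_cubeNoise {n m : ℕ} {M : Mechanism n m} {ε δ : ℝ} (hε : 0 < ε)
    (hδ : 0 ≤ δ) (hM : IsDP M ε δ) {k : ℕ} (hk : k * ε ≤ 1 / 2) (hk' : 1 ≤ 4 * (k * ε))
    (hdt : deltaTilde ε δ < 1) (A : Matrix (Fin m) (Fin n) ℝ)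
    (hL : ∀ i, MemLp (fun z => z i) 2 (cubeNoise M A k)) (θ : Fin m → ℝ) (j : Fin n) :
    (θ ⬝ᵥ A.col j) ^ 2 ≤
      (16 * ε / (1 - deltaTilde ε δ)) ^ 2 * ∫ z, (θ ⬝ᵥ z) ^ 2 ∂cubeNoise M A k := by
  have he : 0 < Real.exp ε - 1 := by
    have := Real.add_one_lt_exp hε.ne'
    linarith
  have he2 : 0 < Real.exp (1 / 2) - 1 := by
    have := Real.add_one_lt_exp (x := 1 / 2) (by norm_num)
    linarith
  set δ' := δ * ((Real.exp (1 / 2) - 1) / (Real.exp ε - 1)) with hδ'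
  have hδ'0 : 0 ≤ δ' := by positivity
  have hdt' : deltaTilde ε δ = 2 * Real.exp (2 * ε) * δ' := by
    rw [deltaTilde, hδ']
    ring
  -- The loss δ' from group privacy is smaller than δ̃ by the factor 2e^{2ε} ≥ 1.
  have hle : δ' ≤ deltaTilde ε δ := by
    have := Real.one_le_exp (x := 2 * ε) (by linarith)
    rw [hdt']
    nlinarith
  set c := 1 - deltaTilde ε δ with hc
  have hc0 : 0 < c := by linarith
  have hc1 : c ≤ 1 := by linarith
  set s := |θ ⬝ᵥ A.col j| with hs
  have hs2 : (θ ⬝ᵥ A.col j) ^ 2 = s ^ 2 := (sq_abs _).symm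
  have htail := hM.cubeNoise_tail hε hδ hk A θ j
  rw [← hδ', ← hs] at htail
  have hint : Integrable (fun z : Fin m → ℝ => (θ ⬝ᵥ z) ^ 2) (cubeNoise M A k) :=
    (memLp_finsetSum _ fun i _ => (hL i).const_mul (θ i)).integrable_sq
  have hmarkov := mul_meas_ge_le_integral_of_nonneg
    (Filter.Eventually.of_forall fun z => sq_nonneg (θ ⬝ᵥ z)) hint ((k * s / 2) ^ 2)
  have hset : {z : Fin m → ℝ | (k * s / 2) ^ 2 ≤ (θ ⬝ᵥ z) ^ 2} =
      {z | k * s / 2 ≤ |θ ⬝ᵥ z|} := by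
    ext z
    have : 0 ≤ k * s / 2 := by positivity
    simp only [Set.mem_ofPred_eq]
    rw [← sq_abs (θ ⬝ᵥ z), sq_le_sq₀ this (abs_nonneg _)]
  rw [hset] at hmarkov
  set q := (cubeNoise M A k).real {z | k * s / 2 ≤ |θ ⬝ᵥ z|}
  set I := ∫ z, (θ ⬝ᵥ z) ^ 2 ∂cubeNoise M A k
  have hq : c / 4 ≤ q := by linarith
  have h1 : (k * s / 2) ^ 2 * (c / 4) ≤ I := (by gcongr : _ ≤ _).trans hmarkov
  rw [hs2, div_pow, div_mul_eq_mul_div, le_div_iff₀ (by positivity)]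
  -- The constant 16 is chosen so that 16² · (1/4) · (1/4) = 4², matching 4kε ≥ 1; one factor c ≤ 1
  -- is given away.
  calc s ^ 2 * c ^ 2 ≤ s ^ 2 * c * (4 * (k * ε)) ^ 2 := by
        rw [sq c, ← mul_assoc]
        gcongr
        exact hc1.trans (one_le_pow₀ hk')
    _ = (16 * ε) ^ 2 * ((k * s / 2) ^ 2 * (c / 4)) := by ring
    _ ≤ (16 * ε) ^ 2 * I := by gcongr

end LinearQueryDP

end

theorem mainTheorem2 :
    ∃ C' : ℝ, 0 < C' ∧
      ∀ (n m : ℕ) (ε δ p : ℝ), 0 < ε → ε < 1 / 2 → 0 ≤ δ → δ ≤ 1 → 2 ≤ p →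
        ∀ (A : Matrix (Fin m) (Fin n) ℝ) (M : LinearQueryDP.Mechanism n m),
          LinearQueryDP.IsDP M ε δ →
            ENNReal.ofReal
                ((1 - LinearQueryDP.deltaTilde ε δ) * LinearQueryDP.gammaNorm p A / (C' * ε)) ≤
              LinearQueryDP.err p M A := by
  refine ⟨16, by norm_num, fun n m ε δ p hε hε2 hδ _ hp A M hM => ?_⟩
  have hp0 : 0 < p := by linarith
  rcases le_or_gt 1 (LinearQueryDP.deltaTilde ε δ) with hdt | hdt
  · rw [ENNReal.ofReal_of_nonpos]
    · exact zero_le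
    · exact div_nonpos_of_nonpos_of_nonneg (mul_nonpos_of_nonpos_of_nonneg (by linarith)
        (LinearQueryDP.gammaNorm_nonneg p A)) (by positivity)
  -- Finite error is what makes the noise moments integrable.
  by_cases herr : LinearQueryDP.err p M A = ⊤
  · rw [herr]
    exact le_top
  have h2ε : 1 ≤ 1 / (2 * ε) := by
    rw [le_div_iff₀ (by positivity)]
    linarith
  -- The largest k with kε ≤ 1/2. Since ε < 1/2 gives k ≥ 1, also 1 < 2(k + 1)ε ≤ 4kε.
  set k : ℕ := ⌊1 / (2 * ε)⌋₊ with hk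
  have hk1 : (k : ℝ) ≤ 1 / (2 * ε) := Nat.floor_le (by positivity)
  have hk2 : 1 / (2 * ε) < k + 1 := Nat.lt_floor_add_one _
  have hk3 : (1 : ℝ) ≤ k := by
    have : 1 ≤ k := Nat.le_floor (by simpa using h2ε)
    exact_mod_cast this
  rw [le_div_iff₀ (by positivity)] at hk1
  rw [div_lt_iff₀ (by positivity)] at hk2
  have hint := LinearQueryDP.integrable_cubeNoise hp0 k herr
  have hc : 0 < 1 - LinearQueryDP.deltaTilde ε δ := by linarith
  have hgamma := LinearQueryDP.gammaNorm_le_of_noise hp hint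
    (K := 16 * ε / (1 - LinearQueryDP.deltaTilde ε δ)) (by positivity)
    (hM.sq_le_integral_cubeNoise hε hδ (by linarith) (by nlinarith) hdt A
      fun i => LinearQueryDP.memLp_two_of_integrable_rpow hp (hint i))
  have hle := LinearQueryDP.sum_integral_cubeNoise_rpow_le hp0 k herr
  refine ENNReal.ofReal_le_of_le_toReal (le_trans ?_ hle)
  rw [div_le_iff₀ (by positivity)]
  calc _ ≤ (1 - LinearQueryDP.deltaTilde ε δ) * _ := mul_le_mul_of_nonneg_left hgamma hc.le
    _ = _ := by field_simp
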